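/- Let $X$ be a Polish space and let $B \subseteq X$ be a nonempty Borel set such that every point of $B$ is a condensation point of $B$, i.e. for every $x \in B$ and every neighbourhood $U$ of $x$ in $X$, the set $U \cap B$ is uncountable. Then there is a continuous bijection from the Baire space $\omega^\omega$ (with the product topology of the discrete spaces $\omega$) onto $B$ (with the subspace topology). -/

import Mathlib

open scoped Topology

/-- A point `x` of a topological space is a condensation point of a set `B` if every
neighbourhood of `x` contains uncountably many points of `B`. -/
def IsCondensationPoint {X : Type*} [TopologicalSpace X] (x : X) (B : Set X) : Prop :=
  ∀ U ∈ 𝓝 x, ¬ (U ∩ B).Countable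

open Set Filter TopologicalSpace

/-! ### Disjoint uncountable Borel sets and countable closures -/

section Uncountable

variable {X : Type*}

/-! A subtree of codes would not suffice: every sequence of naturals must name exactly one point.
`IsSelfCondensed.exists_split` therefore splits a self-condensed Borel set into countably many
centers and, around each center, a sequence of rings shrinking to it, each ring cut into exactly
countably infinitely many self-condensed pieces. The first input selects a center. Afterwards, 0
discards the outermost remaining ring, and a nonzero input selects a piece of that ring and a center
of that piece. The diameters of the surviving regions tend to 0, which gives continuity and
injectivity of the naming; the splittings are partitions, so each point has exactly one code.

It remains to see that every code names a point. If the code is eventually 0, the last center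
survives. Otherwise the region centers form a Cauchy sequence, but their limit might leave the set,
since the pieces are only Borel. `MeasurableSet.exists_controlsLimits` prevents this: a Borel set
contains the limits of those of its sequences along which countably many Borel functions stabilize.
Each splitting makes more of these functions constant on the pieces. -/

theorem MeasurableSet.exists_continuum_disjoint_uncountable_subsets [MeasurableSpace X]
    [StandardBorelSpace X] {A : Set X} (hA : MeasurableSet A) (hunc : ¬ A.Countable) :
    ∃ L : ℝ → Set X, (∀ a, MeasurableSet (L a) ∧ L a ⊆ A ∧ ¬ (L a).Countable) ∧
      ∀ a b, a ≠ b → Disjoint (L a) (L b) := by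
  have : StandardBorelSpace A := hA.standardBorel
  have h1 : ¬ Countable A := hunc
  have h2 : ¬ Countable (ℝ × ℝ) := fun h => by
    have : Countable ℝ := (Prod.mk_right_injective (0 : ℝ)).countable
    exact not_countable this
  let e : A ≃ᵐ ℝ × ℝ := PolishSpace.measurableEquivOfNotCountable h1 h2
  refine ⟨fun a => Subtype.val '' (e ⁻¹' (Prod.fst ⁻¹' {a})), fun a => ⟨?_, ?_, ?_⟩, ?_⟩
  · exact hA.subtype_image (e.measurable (measurable_fst (measurableSet_singleton a)))
  · exact Subtype.coe_image_subset _ _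
  · intro hc
    have hc' := hc.preimage_of_injOn (f := fun b : ℝ => (e.symm (a, b) : X))
      (by
        intro b _ b' _ h
        have := e.symm.injective (Subtype.val_injective h)
        exact (Prod.mk.inj this).2)
    have : (fun b : ℝ => (e.symm (a, b) : X)) ⁻¹'
        (Subtype.val '' (e ⁻¹' (Prod.fst ⁻¹' {a}))) = univ := by
      refine eq_univ_of_forall fun b => ⟨e.symm (a, b), ?_, rfl⟩
      simp
    rw [this] at hc'
    exact not_countable (countable_univ_iff.1 hc')
  · intro a b hab
    rw [Set.disjoint_left]
    rintro _ ⟨x, hx, rfl⟩ ⟨y, hy, hxy⟩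
    obtain rfl := Subtype.val_injective hxy
    exact hab (hx.symm.trans hy)

/-- Among continuum many disjoint candidates, each `E m` rules out at most one: two sets with
countable remainder in `E m` would have to overlap. So all but countably many candidates work. -/
theorem MeasurableSet.exists_uncountable_subset_diff_uncountable [MeasurableSpace X]
    [StandardBorelSpace X] {E : ℕ → Set X} (hE : ∀ m, MeasurableSet (E m))
    (hunc : ∀ m, ¬ (E m).Countable) (n : ℕ) :
    ∃ L ⊆ E n, MeasurableSet L ∧ ¬ L.Countable ∧ ∀ m, ¬ (E m \ L).Countable := by
  obtain ⟨L, hL, hdisj⟩ :=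
    MeasurableSet.exists_continuum_disjoint_uncountable_subsets (hE n) (hunc n)
  have hbad : ∀ m, {a | (E m \ L a).Countable}.Subsingleton := by
    intro m a ha b hb
    by_contra hab
    refine hunc m ((ha.union hb).mono fun x hx => ?_)
    by_cases hxa : x ∈ L a
    · exact Or.inr ⟨hx, fun hxb => (Set.disjoint_left.1 (hdisj a b hab)) hxa hxb⟩
    · exact Or.inl ⟨hx, hxa⟩
  have hc : (⋃ m, {a | (E m \ L a).Countable}).Countable :=
    countable_iUnion fun m => (hbad m).countable
  obtain ⟨a, ha⟩ : ∃ a, a ∉ ⋃ m, {a | (E m \ L a).Countable} := by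
    by_contra! h
    exact not_countable (countable_univ_iff.1 ((eq_univ_of_forall h) ▸ hc))
  simp only [mem_iUnion, mem_ofPred_eq, not_exists] at ha
  exact ⟨L a, (hL a).2.1, (hL a).1, (hL a).2.2, ha⟩

/-- Countably many uncountable Borel sets contain pairwise disjoint uncountable Borel sets. -/
theorem MeasurableSet.exists_disjoint_uncountable_subsets [MeasurableSpace X]
    [StandardBorelSpace X] {E : ℕ → Set X} (hE : ∀ m, MeasurableSet (E m))
    (hunc : ∀ m, ¬ (E m).Countable) :
    ∃ K : ℕ → Set X, (∀ m, K m ⊆ E m ∧ MeasurableSet (K m) ∧ ¬ (K m).Countable) ∧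
      Pairwise (Function.onFun Disjoint K) := by
  -- Greedy choice: `F` is what has been used so far, and the invariant leaves every `E m`
  -- uncountable outside it.
  let S := {F : Set X // MeasurableSet F ∧ ∀ m, ¬ (E m \ F).Countable}
  have step : ∀ (n : ℕ) (F : S), ∃ L ⊆ E n \ F.1, MeasurableSet L ∧ ¬ L.Countable ∧
      ∀ m, ¬ ((E m \ F.1) \ L).Countable := fun n F =>
    MeasurableSet.exists_uncountable_subset_diff_uncountable
      (fun m => (hE m).diff F.2.1) F.2.2 n
  choose L hLsub hLmeas hLunc hLdiff using step
  let F : ℕ → S := fun n => Nat.rec ⟨∅, MeasurableSet.empty, by simpa using hunc⟩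
    (fun n F => ⟨F.1 ∪ L n F, F.2.1.union (hLmeas n F), fun m => by
      rw [← sdiff_sdiff]; exact hLdiff n F m⟩) n
  have hsucc : ∀ n, (F (n + 1)).1 = (F n).1 ∪ L n (F n) := fun n => rfl
  have hmono : Monotone fun n => (F n).1 :=
    monotone_nat_of_le_succ fun n => by rw [hsucc]; exact subset_union_left
  refine ⟨fun n => L n (F n), fun m => ⟨fun x hx => (hLsub m _ hx).1, hLmeas _ _, hLunc _ _⟩, ?_⟩
  refine (pairwise_disjoint_on _).2 fun m n hmn => ?_
  rw [Set.disjoint_left]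
  intro x hx hx'
  refine (hLsub n _ hx').2 (hmono (Nat.succ_le_of_lt hmn) ?_)
  change x ∈ (F (m + 1)).1
  rw [hsucc]
  exact Or.inr hx

/-- A countable set can be enlarged to a countable set closed under a countable-valued operation. -/
theorem Set.Countable.exists_countable_closed_superset {S B : Set X} (hS : S.Countable)
    (hSB : S ⊆ B) (N : X → Set X) (hN : ∀ x, (N x).Countable) (hNB : ∀ x, N x ⊆ B) :
    ∃ C, S ⊆ C ∧ C ⊆ B ∧ C.Countable ∧ ∀ x ∈ C, N x ⊆ C := by
  let D : ℕ → Set X := fun n => Nat.rec S (fun _ D => ⋃ x ∈ D, N x) n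
  have hD : ∀ n, (D n).Countable ∧ D n ⊆ B := by
    intro n
    induction n with
    | zero => exact ⟨hS, hSB⟩
    | succ n ih => exact ⟨ih.1.biUnion fun x _ => hN x, iUnion₂_subset fun x _ => hNB x⟩
  refine ⟨⋃ n, D n, subset_iUnion D 0, iUnion_subset fun n => (hD n).2,
    countable_iUnion fun n => (hD n).1, fun x hx y hy => ?_⟩
  obtain ⟨n, hn⟩ := mem_iUnion.1 hx
  exact mem_iUnion.2 ⟨n + 1, mem_iUnion₂.2 ⟨x, hn, hy⟩⟩

theorem Set.Infinite.exists_bijOn_nat [Countable X] {S : Set X} (hS : S.Infinite) :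
    ∃ e : X → ℕ, BijOn e S univ := by
  have : Infinite S := hS.to_subtype
  obtain ⟨d⟩ := nonempty_denumerable S
  classical
  refine ⟨fun x => if h : x ∈ S then Denumerable.eqv S ⟨x, h⟩ else 0, fun _ _ => mem_univ _, ?_, ?_⟩
  · intro x hx y hy h
    simp only [hx, hy, dif_pos] at h
    exact congrArg Subtype.val ((Denumerable.eqv S).injective h)
  · intro n _
    refine ⟨((Denumerable.eqv S).symm n).1, ((Denumerable.eqv S).symm n).2, ?_⟩
    simp

end Uncountable

/-! ### Condensation points -/

section Condensation

variable {X : Type*} [TopologicalSpace X]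

theorem countable_setOf_not_isCondensationPoint [SecondCountableTopology X] (Z : Set X) :
    {x ∈ Z | ¬ IsCondensationPoint x Z}.Countable := by
  refine ((((countable_countableBasis X).mono
    (sep_subset _ fun U => (U ∩ Z).Countable))).biUnion (t := fun U _ => U ∩ Z)
      fun U hU => hU.2).mono ?_
  rintro x ⟨hx, hnc⟩
  simp only [IsCondensationPoint, not_forall, not_not] at hnc
  obtain ⟨U, hU, hc⟩ := hnc
  obtain ⟨V, hV, hxV, hVU⟩ := (isBasis_countableBasis X).mem_nhds_iff.1 hU
  exact mem_iUnion₂.2 ⟨V, ⟨hV, hc.mono (inter_subset_inter_left _ hVU)⟩, hxV, hx⟩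

theorem IsCondensationPoint.diff_countable {x : X} {B C : Set X} (h : IsCondensationPoint x B)
    (hC : C.Countable) : IsCondensationPoint x (B \ C) := by
  intro U hU hc
  refine h U hU ((hc.union hC).mono fun y hy => ?_)
  by_cases hyC : y ∈ C
  · exact Or.inr hyC
  · exact Or.inl ⟨hy.1, hy.2, hyC⟩

/-- A self-condensed Borel set splits into countably many Borel classes, each of which condenses
at every point of the set. -/
theorem MeasurableSet.exists_condensing_labelling [PolishSpace X] [MeasurableSpace X] [BorelSpace X]
    {B : Set X} (hB : MeasurableSet B) (hcond : ∀ x ∈ B, IsCondensationPoint x B) :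
    ∃ θ : X → ℕ, Measurable θ ∧ ∀ x ∈ B, ∀ j, IsCondensationPoint x (B ∩ θ ⁻¹' {j}) := by
  rcases B.eq_empty_or_nonempty with rfl | ⟨x₀, hx₀⟩
  · exact ⟨fun _ => 0, measurable_const, by simp⟩
  let 𝒰 := {U ∈ countableBasis X | ¬ (U ∩ B).Countable}
  have h𝒰 : 𝒰.Countable := (countable_countableBasis X).mono (sep_subset _ _)
  have hbasis : ∀ x ∈ B, ∀ U ∈ 𝓝 x, ∃ V ∈ 𝒰, V ⊆ U := by
    intro x hx U hU
    obtain ⟨V, hV, hxV, hVU⟩ := (isBasis_countableBasis X).mem_nhds_iff.1 hU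
    exact ⟨V, ⟨hV, hcond x hx V ((isBasis_countableBasis X).mem_nhds hV hxV)⟩, hVU⟩
  have hne : 𝒰.Nonempty := let ⟨V, hV, _⟩ := hbasis x₀ hx₀ univ univ_mem; ⟨V, hV⟩
  obtain ⟨u, hu⟩ := h𝒰.exists_eq_range hne
  have hu' : ∀ n, u n ∈ 𝒰 := fun n => hu ▸ mem_range_self n
  obtain ⟨K, hK, hdisj⟩ := MeasurableSet.exists_disjoint_uncountable_subsets
    -- Each basic set is listed infinitely often; the second coordinate of `m.unpair` becomes the
    -- label, so every basic set receives an uncountable piece of every label.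
    (E := fun m => u m.unpair.1 ∩ B)
    (fun m => ((isBasis_countableBasis X).isOpen (hu' _).1).measurableSet.inter hB)
    (fun m => (hu' _).2)
  classical
  -- The second alternative makes the search succeed, with value 0, off the union.
  have hp : ∀ x, ∃ m, x ∈ K m ∨ x ∉ ⋃ n, K n := by
    intro x
    by_cases hx : x ∈ ⋃ n, K n
    · exact (mem_iUnion.1 hx).imp fun _ => Or.inl
    · exact ⟨0, Or.inr hx⟩
  have hmeas : Measurable fun x => Nat.find (hp x) :=
    measurable_find hp fun m => (hK m).2.1.union (MeasurableSet.iUnion fun n => (hK n).2.1).compl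
  have hfind : ∀ m, ∀ x ∈ K m, Nat.find (hp x) = m := by
    intro m x hx
    rcases Nat.find_spec (hp x) with h | h
    · by_contra hne
      exact Set.disjoint_left.1 (hdisj hne) h hx
    · exact absurd (mem_iUnion.2 ⟨m, hx⟩) h
  refine ⟨fun x => (Nat.find (hp x)).unpair.2,
    (measurable_of_countable fun m : ℕ => m.unpair.2).comp hmeas, fun x hx j U hU hc => ?_⟩
  obtain ⟨V, hV, hVU⟩ := hbasis x hx U hU
  obtain ⟨n, rfl⟩ : V ∈ range u := hu ▸ hV
  refine (hK (Nat.pair n j)).2.2 (hc.mono fun y hy => ?_)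
  have h1 := (hK (Nat.pair n j)).1 hy
  simp only [Nat.unpair_pair] at h1
  refine ⟨hVU h1.1, h1.2, ?_⟩
  change (Nat.unpair (Nat.find (hp y))).2 = j
  rw [hfind _ y hy, Nat.unpair_pair]

end Condensation

/-! ### Borel sets and controlled limits -/

section LimitControl

variable {X : Type*} [TopologicalSpace X]

/-- Limits of sequences in `R` along which every `Φ k` stabilizes stay in `R`. -/
def ControlsLimits (Φ : ℕ → X → ℕ) (R : Set X) : Prop :=
  ∀ (y : ℕ → X) (z : X), (∀ᶠ n in atTop, y n ∈ R) → Tendsto y atTop (𝓝 z) →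
    (∀ k, ∃ a, ∀ᶠ n in atTop, Φ k (y n) = a) → z ∈ R

theorem ControlsLimits.of_refinement {Φ Ψ : ℕ → X → ℕ} {R : Set X} (h : ControlsLimits Φ R)
    (g : ℕ → ℕ → ℕ) (hg : ∀ k, ∃ l, ∀ x, g k (Ψ l x) = Φ k x) : ControlsLimits Ψ R := by
  intro y z hy hz hc
  refine h y z hy hz fun k => ?_
  obtain ⟨l, hl⟩ := hg k
  obtain ⟨a, ha⟩ := hc l
  exact ⟨g k a, ha.mono fun n hn => by rw [← hl, hn]⟩

theorem ControlsLimits.iInter {Φ : ℕ → ℕ → X → ℕ} {R : ℕ → Set X}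
    (h : ∀ i, ControlsLimits (Φ i) (R i)) :
    ControlsLimits (fun k => Φ k.unpair.1 k.unpair.2) (⋂ i, R i) := by
  intro y z hy hz hc
  refine mem_iInter.2 fun i => h i y z (hy.mono fun n hn => mem_iInter.1 hn i) hz fun k => ?_
  simpa using hc (Nat.pair i k)

/-- The selector `s` is added to the controls: once it stabilizes, the sequence stays in a single `R
i`. -/
theorem ControlsLimits.iUnion {Φ : ℕ → ℕ → X → ℕ} {R : ℕ → Set X}
    (h : ∀ i, ControlsLimits (Φ i) (R i)) {s : X → ℕ} (hs : ∀ x ∈ ⋃ i, R i, x ∈ R (s x)) :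
    ControlsLimits (fun k => Nat.casesOn k s fun k => Φ k.unpair.1 k.unpair.2) (⋃ i, R i) := by
  intro y z hy hz hc
  obtain ⟨i, hi⟩ := hc 0
  refine mem_iUnion.2 ⟨i, h i y z ?_ hz fun k => ?_⟩
  · filter_upwards [hy, hi] with n hn hn'
    exact hn' ▸ hs _ hn
  · simpa using hc (Nat.pair i k + 1)

theorem IsClosed.controlsLimits {R : Set X} (hR : IsClosed R) (Φ : ℕ → X → ℕ) :
    ControlsLimits Φ R := fun _ _ hy hz _ => hR.mem_of_tendsto hz hy

variable [MeasurableSpace X]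

theorem exists_controlsLimits_iInter {R : ℕ → Set X}
    (h : ∀ i, ∃ Φ : ℕ → X → ℕ, (∀ k, Measurable (Φ k)) ∧ ControlsLimits Φ (R i)) :
    ∃ Φ : ℕ → X → ℕ, (∀ k, Measurable (Φ k)) ∧ ControlsLimits Φ (⋂ i, R i) := by
  choose Φ hm hc using h
  exact ⟨_, fun k => hm _ _, ControlsLimits.iInter hc⟩

theorem exists_controlsLimits_iUnion {R : ℕ → Set X} (hR : ∀ i, MeasurableSet (R i))
    (h : ∀ i, ∃ Φ : ℕ → X → ℕ, (∀ k, Measurable (Φ k)) ∧ ControlsLimits Φ (R i)) :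
    ∃ Φ : ℕ → X → ℕ, (∀ k, Measurable (Φ k)) ∧ ControlsLimits Φ (⋃ i, R i) := by
  choose Φ hm hc using h
  classical
  have hp : ∀ x, ∃ m, x ∈ R m ∨ x ∉ ⋃ n, R n := by
    intro x
    by_cases hx : x ∈ ⋃ n, R n
    · exact (mem_iUnion.1 hx).imp fun _ => Or.inl
    · exact ⟨0, Or.inr hx⟩
  refine ⟨_, fun k => ?_, ControlsLimits.iUnion hc (s := fun x => Nat.find (hp x)) fun x hx =>
    (Nat.find_spec (hp x)).resolve_right (not_not.2 hx)⟩
  cases k with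
  | zero => exact measurable_find hp fun m => (hR m).union (MeasurableSet.iUnion hR).compl
  | succ k => exact hm _ _

/-- A substitute for refining the topology so that `R` becomes closed. The Borel induction treats
`R` and `Rᶜ` together, since controls for a set give none for its complement. -/
theorem MeasurableSet.exists_controlsLimits [MetrizableSpace X] [BorelSpace X] {R : Set X}
    (hR : MeasurableSet R) :
    ∃ Φ : ℕ → X → ℕ, (∀ k, Measurable (Φ k)) ∧ ControlsLimits Φ R := by
  have hclosed : ∀ F : Set X, IsClosed F →
      ∃ Φ : ℕ → X → ℕ, (∀ k, Measurable (Φ k)) ∧ ControlsLimits Φ F := fun F hF =>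
    ⟨fun _ _ => 0, fun _ => measurable_const, hF.controlsLimits _⟩
  suffices h : (∃ Φ : ℕ → X → ℕ, (∀ k, Measurable (Φ k)) ∧ ControlsLimits Φ R) ∧
      ∃ Φ : ℕ → X → ℕ, (∀ k, Measurable (Φ k)) ∧ ControlsLimits Φ Rᶜ from h.1
  induction R, hR using MeasurableSet.induction_on_open with
  | isOpen U hU =>
    refine ⟨?_, hclosed _ hU.isClosed_compl⟩
    let := metrizableSpaceMetric X
    obtain ⟨F, hF, -, rfl, -⟩ := hU.exists_iUnion_isClosed
    exact exists_controlsLimits_iUnion (fun i => (hF i).measurableSet) fun i => hclosed _ (hF i)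
  | compl t _ ih => exact ⟨ih.2, by rw [compl_compl]; exact ih.1⟩
  | iUnion f _ hf ih =>
    refine ⟨exists_controlsLimits_iUnion hf fun i => (ih i).1, ?_⟩
    rw [compl_iUnion]
    exact exists_controlsLimits_iInter fun i => (ih i).2

end LimitControl

/-! ### Splitting a self-condensed set into centers and rings -/

section Splitting

/-- A nonempty Borel set all of whose points are its condensation points. -/
structure IsSelfCondensed {X : Type*} [TopologicalSpace X] [MeasurableSpace X] (B : Set X) :
    Prop where
  measurableSet : MeasurableSet B
  nonempty : B.Nonempty
  condensation : ∀ x ∈ B, IsCondensationPoint x B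

theorem IsSelfCondensed.infinite {X : Type*} [TopologicalSpace X] [MeasurableSpace X] {B : Set X}
    (hB : IsSelfCondensed B) : B.Infinite := by
  obtain ⟨x, hx⟩ := hB.nonempty
  intro hfin
  exact hB.condensation x hx univ univ_mem (by simpa using hfin.countable)

variable {X : Type*} [MetricSpace X]

/-- The depth of `x` in the sequence of shrinking annuli around `c`, starting at radius
`1 / (n + 1)`. -/
noncomputable def annulusIndex (n : ℕ) (c x : X) : ℕ := ⌊(dist x c)⁻¹⌋₊ - n

/-- Index 0 carries no bound: truncated subtraction sends all far points there. -/
theorem mul_dist_le_of_le_annulusIndex {n k : ℕ} {c x : X} (hk : k ≠ 0)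
    (h : k ≤ annulusIndex n c x) : ((n + k : ℕ) : ℝ) * dist x c ≤ 1 := by
  unfold annulusIndex at h
  have h1 : n + k ≤ ⌊(dist x c)⁻¹⌋₊ := by omega
  have h2 : ((n + k : ℕ) : ℝ) ≤ (dist x c)⁻¹ :=
    (Nat.cast_le.2 h1).trans (Nat.floor_le (by positivity))
  calc ((n + k : ℕ) : ℝ) * dist x c ≤ (dist x c)⁻¹ * dist x c := by gcongr
    _ ≤ 1 := inv_mul_le_one

theorem exists_nhds_le_annulusIndex (n r : ℕ) (c : X) :
    ∃ U ∈ 𝓝 c, ∀ x ∈ U, x ≠ c → r ≤ annulusIndex n c x := by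
  refine ⟨Metric.ball c ((n + r + 1 : ℕ) : ℝ)⁻¹, Metric.ball_mem_nhds _ (by positivity),
    fun x hx hxc => ?_⟩
  have hpos : 0 < dist x c := dist_pos.2 hxc
  have h1 : ((n + r + 1 : ℕ) : ℝ) ≤ (dist x c)⁻¹ :=
    (le_inv_comm₀ hpos (by positivity)).1 (Metric.mem_ball.1 hx).le
  have h2 := Nat.le_floor h1
  unfold annulusIndex
  omega

theorem measurable_annulusIndex [SecondCountableTopology X] [MeasurableSpace X] [BorelSpace X]
    (n : ℕ) (c : X) : Measurable (annulusIndex n c) :=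
  (measurable_of_countable fun m : ℕ => m - n).comp
    (Nat.measurable_floor.comp (measurable_id.dist measurable_const).inv)

variable [CompleteSpace X] [SecondCountableTopology X] [MeasurableSpace X] [BorelSpace X]

/-- A self-condensed Borel set is the disjoint union of points `c j` and of self-condensed sets
`R j k i`, where `R j k i` converges to `c j` as `k → ∞` and `ψ k` is constant on it. The partition
is recorded by a labelling of the points. -/
theorem IsSelfCondensed.exists_split {B : Set X} (hB : IsSelfCondensed B) {ψ : ℕ → X → ℕ}
    (hψ : ∀ k, Measurable (ψ k)) (n : ℕ) :
    ∃ (c : ℕ → X) (lab : X → ℕ × Option (ℕ × ℕ)),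
      (∀ j, c j ∈ B ∧ lab (c j) = (j, none)) ∧ (∀ x ∈ B, ∀ j, lab x = (j, none) → x = c j) ∧
      ∀ j k i, IsSelfCondensed {x ∈ B | lab x = (j, some (k, i))} ∧
        (∀ x ∈ B, ∀ y ∈ B, lab x = (j, some (k, i)) → lab y = (j, some (k, i)) → ψ k x = ψ k y) ∧
        ∀ x ∈ B, lab x = (j, some (k, i)) → k ≠ 0 → ((n + k : ℕ) : ℝ) * dist x (c j) ≤ 1 := by
  obtain ⟨θ, hθ, hθB⟩ := hB.measurableSet.exists_condensing_labelling hB.condensation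
  let Z : X → ℕ → ℕ → ℕ → ℕ → Set X := fun p s r k i =>
    {x ∈ B | θ x = s ∧ annulusIndex n p x = r ∧ ψ k x = i}
  -- The countably many points that spoil the cells around `p`. The cells depend on the centers, so
  -- the set `C` of centers must be closed under `N`; then `Z \ C` is self-condensed when its center
  -- lies in `C`.
  let N : X → Set X := fun p => ⋃ (s) (r) (k) (i), {x ∈ Z p s r k i |
    ¬ IsCondensationPoint x (Z p s r k i)}
  have hN : ∀ p, (N p).Countable := fun p => countable_iUnion fun s => countable_iUnion fun r =>
    countable_iUnion fun k => countable_iUnion fun i => countable_setOf_not_isCondensationPoint _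
  have hNB : ∀ p, N p ⊆ B := fun p x hx => by
    simp only [N, mem_iUnion] at hx
    obtain ⟨s, r, k, i, hx⟩ := hx
    exact hx.1.1
  let emb := hB.infinite.natEmbedding
  obtain ⟨C, hSC, hCB, hCc, hCN⟩ := (countable_range fun m => (emb m : X)
    ).exists_countable_closed_superset (B := B) (by rintro _ ⟨m, rfl⟩; exact (emb m).2) N hN hNB
  have hCinf : C.Infinite := (infinite_range_of_injective
    (Subtype.val_injective.comp emb.injective)).mono hSC
  have := hCinf.to_subtype
  have := hCc.to_subtype
  obtain ⟨d⟩ := nonempty_denumerable C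
  let e : C ≃ ℕ := Denumerable.eqv C
  let c : ℕ → X := fun j => e.symm j
  have hcC : ∀ j, c j ∈ C := fun j => (e.symm j).2
  -- Triples (secondary label `t`, annulus `r`, value of `ψ k`) of the nonempty cells in ring `k`
  -- around `c j`, where the ring number is `min t r`.
  let S : ℕ → ℕ → Set (ℕ × ℕ × ℕ) := fun j k =>
    {q | min q.1 q.2.1 = k ∧ (Z (c j) (Nat.pair j q.1) q.2.1 k q.2.2 \ C).Nonempty}
  have hS : ∀ j k, (S j k).Infinite := by
    intro j k
    refine Infinite.of_image (fun q => q.2.1) (infinite_of_not_bddAbove ?_)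
    rintro ⟨b, hb⟩
    -- The class labelled `(j, k)` condenses at `c j`, so it meets arbitrarily deep annuli; there
    -- `min k r = k`, so ring `k` has cells with unbounded `r`.
    obtain ⟨U, hU, hUr⟩ := exists_nhds_le_annulusIndex n (max k (b + 1)) (c j)
    obtain ⟨x, hxU, ⟨hxB, hxθ⟩, hxC⟩ : (U ∩ ((B ∩ θ ⁻¹' {Nat.pair j k}) \ C)).Nonempty := by
      rw [nonempty_iff_ne_empty]
      intro h0
      exact (hθB _ (hCB (hcC j)) _).diff_countable hCc U hU (h0 ▸ countable_empty)
    have hr := hUr x hxU (fun h => hxC (h ▸ hcC j))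
    have hrb : annulusIndex n (c j) x ≤ b := hb ⟨(k, annulusIndex n (c j) x, ψ k x),
      ⟨min_eq_left ((le_max_left _ _).trans hr), x, ⟨hxB, hxθ, rfl, rfl⟩, hxC⟩, rfl⟩
    have := (le_max_right k (b + 1)).trans hr
    omega
  choose ix hix using fun j k => (hS j k).exists_bijOn_nat
  classical
  -- `θ` assigns the center and `t`. Taking `min t r` keeps ring `k` at annulus depth at least `k`,
  -- while `t` makes every ring infinite; `ix` then numbers its cells without gaps.
  let lab : X → ℕ × Option (ℕ × ℕ) := fun x =>
    if h : x ∈ C then (e ⟨x, h⟩, none) else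
      let j := (θ x).unpair.1
      let t := (θ x).unpair.2
      let r := annulusIndex n (c j) x
      (j, some (min t r, ix j (min t r) (t, r, ψ (min t r) x)))
  have hlabC : ∀ x (h : x ∈ C), lab x = (e ⟨x, h⟩, none) := fun x h => dif_pos h
  have hlab : ∀ j k i, ∃ q ∈ S j k, ∀ x ∈ B, lab x = (j, some (k, i)) ↔
      x ∈ Z (c j) (Nat.pair j q.1) q.2.1 k q.2.2 \ C := by
    intro j k i
    obtain ⟨q, hq, hqi⟩ := (hix j k).surjOn (mem_univ i)
    refine ⟨q, hq, fun x hxB => ?_⟩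
    by_cases hxC : x ∈ C
    · simp [hlabC x hxC, hxC]
    have hlx : lab x = ((θ x).unpair.1, some (min (θ x).unpair.2
        (annulusIndex n (c (θ x).unpair.1) x), _)) := dif_neg hxC
    rw [hlx]
    constructor
    · intro h
      simp only [Prod.mk.injEq, Option.some.injEq] at h
      obtain ⟨rfl, rfl, hi⟩ := h
      rw [← hqi] at hi
      have hmem : ((θ x).unpair.2, annulusIndex n (c (θ x).unpair.1) x,
          ψ (min (θ x).unpair.2 (annulusIndex n (c (θ x).unpair.1) x)) x) ∈
          S (θ x).unpair.1 (min (θ x).unpair.2 (annulusIndex n (c (θ x).unpair.1) x)) :=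
        ⟨rfl, x, ⟨hxB, (Nat.pair_unpair _).symm, rfl, rfl⟩, hxC⟩
      have := (hix _ _).injOn hmem hq hi
      rw [← this]
      exact ⟨⟨hxB, (Nat.pair_unpair _).symm, rfl, rfl⟩, hxC⟩
    · rintro ⟨⟨-, h1, h2, h3⟩, -⟩
      have hk := hq.1
      have ht : (θ x).unpair = (j, q.1) := by rw [h1, Nat.unpair_pair]
      simp only [ht, h2, hk, h3, Prod.mk.injEq, Option.some.injEq, true_and]
      exact hqi
  refine ⟨c, lab, fun j => ⟨hCB (hcC j), ?_⟩, fun x hx j h => ?_, fun j k i => ?_⟩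
  · rw [hlabC _ (hcC j)]
    simp [c]
  · by_cases hxC : x ∈ C
    · rw [hlabC x hxC, Prod.mk.injEq] at h
      simp [c, ← h.1]
    · have : lab x = (_, some _) := dif_neg hxC
      simp [this] at h
  · obtain ⟨q, hq, hqx⟩ := hlab j k i
    have hset : {x ∈ B | lab x = (j, some (k, i))} =
        Z (c j) (Nat.pair j q.1) q.2.1 k q.2.2 \ C := by
      ext x
      exact ⟨fun h => (hqx x h.1).1 h.2, fun h => ⟨h.1.1, (hqx x h.1.1).2 h⟩⟩
    refine ⟨?_, fun x hx y hy hlx hly => ?_, fun x hx hlx hk => ?_⟩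
    · rw [hset]
      refine ⟨(hB.measurableSet.inter ((hθ (measurableSet_singleton _)).inter
        ((measurable_annulusIndex n _ (measurableSet_singleton _)).inter
          (hψ k (measurableSet_singleton _))))).diff hCc.measurableSet, hq.2, fun x hx => ?_⟩
      refine IsCondensationPoint.diff_countable ?_ hCc
      by_contra hnc
      refine hx.2 (hCN _ (hcC j) ?_)
      simp only [N, mem_iUnion]
      exact ⟨_, _, _, _, hx.1, hnc⟩
    · exact ((hqx x hx).1 hlx).1.2.2.2.trans ((hqx y hy).1 hly).1.2.2.2.symm
    · refine mul_dist_le_of_le_annulusIndex hk ?_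
      rw [((hqx x hx).1 hlx).1.2.2.1, ← hq.1]
      exact min_le_right _ _

end Splitting

/-! ### The scheme of controlled sets -/

section Scheme

variable {X : Type*} [MetricSpace X] [MeasurableSpace X]

/-- A separable metric space has countable Borel partitions into cells of small diameter. -/
theorem exists_measurable_small_cells [SecondCountableTopology X] [OpensMeasurableSpace X] (m : ℕ) :
    ∃ φ : X → ℕ, Measurable φ ∧ ∀ x y, φ x = φ y → (m : ℝ) * dist x y ≤ 2 := by
  cases isEmpty_or_nonempty X
  · exact ⟨fun _ => 0, measurable_const, fun x => isEmptyElim x⟩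
  have hp : ∀ x : X, ∃ i, (m : ℝ) * dist x (denseSeq X i) < 1 := by
    intro x
    obtain ⟨i, hi⟩ := (denseRange_denseSeq X).exists_dist_lt x
      (by positivity : (0 : ℝ) < ((m : ℝ) + 1)⁻¹)
    refine ⟨i, ?_⟩
    have h1 : dist x (denseSeq X i) * ((m : ℝ) + 1) < 1 := (lt_inv_mul_iff₀' (by positivity)).1
      (by simpa using hi)
    nlinarith [dist_nonneg (x := x) (y := denseSeq X i)]
  classical
  refine ⟨fun x => Nat.find (hp x), measurable_find hp fun k => ?_, fun x y hxy => ?_⟩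
  · exact measurableSet_lt (measurable_const.mul (measurable_id.dist measurable_const))
      measurable_const
  · have h1 := Nat.find_spec (hp x)
    have h2 := Nat.find_spec (hp y)
    rw [show Nat.find (hp x) = Nat.find (hp y) from hxy] at h1
    have h3 := dist_triangle_right x y (denseSeq X (Nat.find (hp y)))
    nlinarith [(Nat.cast_nonneg m : (0 : ℝ) ≤ m)]

variable (X) in
/-- A self-condensed Borel set of diameter at most `2 / level`, with functions controlling its
limit points. -/
structure ControlledSet where
  carrier : Set X
  ctrl : ℕ → X → ℕ
  level : ℕ
  isSelfCondensed : IsSelfCondensed carrier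
  measurable_ctrl : ∀ k, Measurable (ctrl k)
  controlsLimits : ControlsLimits ctrl carrier
  mul_dist_le : ∀ x ∈ carrier, ∀ y ∈ carrier, (level : ℝ) * dist x y ≤ 2

/-- A splitting of a controlled set into centers and controlled children. -/
structure ControlledSet.Splitting (N : ControlledSet X) where
  center : ℕ → X
  label : X → ℕ × Option (ℕ × ℕ)
  child : ℕ → ℕ → ℕ → ControlledSet X
  center_mem : ∀ j, center j ∈ N.carrier
  label_center : ∀ j, label (center j) = (j, none)
  eq_center : ∀ x ∈ N.carrier, ∀ j, label x = (j, none) → x = center j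
  mem_child : ∀ j k i x, x ∈ (child j k i).carrier ↔ x ∈ N.carrier ∧ label x = (j, some (k, i))
  level_child : ∀ j k i, (child j k i).level = N.level + k + 1
  ctrl_const : ∀ j k i, ∀ a ≤ N.level, ∀ x ∈ (child j k i).carrier, ∀ y ∈ (child j k i).carrier,
    N.ctrl a x = N.ctrl a y
  ctrl_refines : ∀ j k i a x y, (child j k i).ctrl a x = (child j k i).ctrl a y →
    N.ctrl a x = N.ctrl a y
  mul_dist_center_le : ∀ j k i, k ≠ 0 → ∀ x ∈ (child j k i).carrier,
    ((N.level + k : ℕ) : ℝ) * dist x (center j) ≤ 1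

/-- `ψ k` encodes a small cell together with the controls up to `N.level`, so its constancy on a
piece gives both the diameter bound and `ctrl_const`. A child's controls pair its own with the
parent's, giving `ctrl_refines`. -/
theorem ControlledSet.nonempty_splitting [CompleteSpace X] [SecondCountableTopology X]
    [BorelSpace X] (N : ControlledSet X) : Nonempty N.Splitting := by
  choose φ hφ hφd using exists_measurable_small_cells (X := X)
  let g : X → Fin (N.level + 1) → ℕ := fun x a => N.ctrl a x
  have hg : Measurable g := measurable_pi_lambda _ fun a => N.measurable_ctrl a
  obtain ⟨c, lab, hc, heq, hR⟩ := N.isSelfCondensed.exists_split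
    (ψ := fun k x => Nat.pair (φ (N.level + k + 1) x) (Encodable.encode (g x)))
    (fun k => (measurable_of_countable fun p : ℕ × (Fin (N.level + 1) → ℕ) =>
      Nat.pair p.1 (Encodable.encode p.2)).comp ((hφ _).prodMk hg)) N.level
  choose Φ hΦ hΦc using fun j k i => (hR j k i).1.measurableSet.exists_controlsLimits
  exact ⟨{
    center := c
    label := lab
    child := fun j k i =>
      { carrier := {x ∈ N.carrier | lab x = (j, some (k, i))}
        ctrl := fun a x => Nat.pair (Φ j k i a x) (N.ctrl a x)
        level := N.level + k + 1
        isSelfCondensed := (hR j k i).1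
        measurable_ctrl := fun a => (measurable_of_countable fun p : ℕ × ℕ =>
          Nat.pair p.1 p.2).comp ((hΦ j k i a).prodMk (N.measurable_ctrl a))
        controlsLimits := (hΦc j k i).of_refinement (fun _ m => m.unpair.1)
          fun a => ⟨a, fun x => by simp⟩
        mul_dist_le := fun x hx y hy => hφd _ x y
          (Nat.pair_eq_pair.1 ((hR j k i).2.1 x hx.1 y hy.1 hx.2 hy.2)).1 }
    center_mem := fun j => (hc j).1
    label_center := fun j => (hc j).2
    eq_center := heq
    mem_child := fun j k i x => Iff.rfl
    level_child := fun j k i => rfl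
    ctrl_const := fun j k i a ha x hx y hy => congrFun (Encodable.encode_injective
      (Nat.pair_eq_pair.1 ((hR j k i).2.1 x hx.1 y hy.1 hx.2 hy.2)).2) ⟨a, Nat.lt_succ_of_le ha⟩
    ctrl_refines := fun j k i a x y h => (Nat.pair_eq_pair.1 h).2
    mul_dist_center_le := fun j k i hk x hx => (hR j k i).2.2 x hx.1 hx.2 hk }⟩

variable (X) in
/-- A controlled set together with one of its centers and the number of rings around the center
that have been discarded. -/
structure SchemeState where
  base : ControlledSet X
  idx : ℕ
  ring : ℕ

/-! ### Codes and trajectories -/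

namespace SchemeState

variable (σ : ∀ N : ControlledSet X, N.Splitting)

def region (s : SchemeState X) : Set X :=
  {x ∈ s.base.carrier | ((σ s.base).label x).1 = s.idx ∧
    ∀ p ∈ ((σ s.base).label x).2, s.ring ≤ p.1}

/-- Input `0` discards a ring; input `m + 1` passes to a region inside that ring. -/
def step (s : SchemeState X) : ℕ → SchemeState X
  | 0 => ⟨s.base, s.idx, s.ring + 1⟩
  | m + 1 => ⟨(σ s.base).child s.idx s.ring m.unpair.1, m.unpair.2, 0⟩

def center (s : SchemeState X) : X := (σ s.base).center s.idx

theorem center_mem_region (s : SchemeState X) : s.center σ ∈ s.region σ :=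
  ⟨(σ s.base).center_mem _, by simp [center, (σ s.base).label_center]⟩

variable {σ}

theorem mem_region_cases {s : SchemeState X} {x : X} (hx : x ∈ s.region σ) :
    x = s.center σ ∨ ∃ k i, s.ring ≤ k ∧ x ∈ ((σ s.base).child s.idx k i).carrier := by
  obtain ⟨hx, h1, h2⟩ := hx
  rcases h : ((σ s.base).label x).2 with _ | ⟨k, i⟩
  · exact Or.inl ((σ s.base).eq_center x hx _ (Prod.ext h1 h))
  · exact Or.inr ⟨k, i, h2 _ h, ((σ s.base).mem_child _ _ _ _).2 ⟨hx, Prod.ext h1 h⟩⟩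

theorem region_step_succ_subset (s : SchemeState X) (m : ℕ) :
    (s.step σ (m + 1)).region σ ⊆ ((σ s.base).child s.idx s.ring m.unpair.1).carrier :=
  fun _ hx => hx.1

theorem child_subset_region (s : SchemeState X) (i : ℕ) :
    ((σ s.base).child s.idx s.ring i).carrier ⊆ s.region σ := by
  intro x hx
  obtain ⟨h1, h2⟩ := ((σ s.base).mem_child _ _ _ _).1 hx
  refine ⟨h1, by rw [h2], fun p hp => ?_⟩
  rw [h2] at hp
  cases hp
  exact le_rfl

theorem region_step_subset (s : SchemeState X) (a : ℕ) :
    (s.step σ a).region σ ⊆ s.region σ := by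
  intro x hx
  cases a with
  | zero => exact ⟨hx.1, hx.2.1, fun p hp => (Nat.le_succ _).trans (hx.2.2 p hp)⟩
  | succ m => exact child_subset_region s _ (region_step_succ_subset s m hx)

/-- The center and the deeper rings survive input 0; a point of the current ring determines its
piece and, through the label in that piece, the next center index. -/
theorem exists_mem_region_step {s : SchemeState X} {x : X} (hx : x ∈ s.region σ) :
    ∃ a, x ∈ (s.step σ a).region σ := by
  by_cases h : ∀ p ∈ ((σ s.base).label x).2, s.ring + 1 ≤ p.1
  · exact ⟨0, hx.1, hx.2.1, h⟩
  · push Not at h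
    obtain ⟨⟨k, i⟩, hp, hlt⟩ := h
    have hk : k = s.ring := le_antisymm (Nat.lt_succ_iff.1 hlt) (hx.2.2 _ hp)
    subst hk
    have hc : x ∈ ((σ s.base).child s.idx s.ring i).carrier :=
      ((σ s.base).mem_child _ _ _ _).2 ⟨hx.1, Prod.ext hx.2.1 hp⟩
    refine ⟨Nat.pair i ((σ ((σ s.base).child s.idx s.ring i)).label x).1 + 1, ?_⟩
    simp only [step, Nat.unpair_pair]
    exact ⟨hc, rfl, fun p _ => Nat.zero_le _⟩

theorem step_unique {s : SchemeState X} {x : X} {a b : ℕ} (ha : x ∈ (s.step σ a).region σ)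
    (hb : x ∈ (s.step σ b).region σ) : a = b := by
  have hlab : ∀ m, x ∈ (s.step σ (m + 1)).region σ →
      (σ s.base).label x = (s.idx, some (s.ring, m.unpair.1)) := fun m hm =>
    (((σ s.base).mem_child _ _ _ _).1 (region_step_succ_subset s m hm)).2
  have hzero : ∀ m, x ∈ (s.step σ 0).region σ → x ∉ (s.step σ (m + 1)).region σ := by
    intro m h0 hm
    have := h0.2.2 (s.ring, m.unpair.1) (by simp [step, hlab m hm])
    simp [step] at this
  match a, b with
  | 0, 0 => rfl
  | 0, m + 1 => exact absurd hb (hzero m ha)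
  | m + 1, 0 => exact absurd ha (hzero m hb)
  | m + 1, m' + 1 =>
    have h1 : m.unpair.1 = m'.unpair.1 := by
      have := (hlab m ha).symm.trans (hlab m' hb)
      simpa using this
    have h2 : m.unpair.2 = m'.unpair.2 := by
      have h3 := ha.2.1
      have h4 := hb.2.1
      simp only [step] at h3 h4
      rw [h1] at h3
      exact h3.symm.trans h4
    rw [← Nat.pair_unpair m, ← Nat.pair_unpair m', h1, h2]

/-- Before any discard this is the diameter bound of the base; afterwards all points are close to
the center. -/
theorem mul_dist_le_of_mem_region {s : SchemeState X} {x y : X} (hx : x ∈ s.region σ)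
    (hy : y ∈ s.region σ) : ((s.base.level + s.ring : ℕ) : ℝ) * dist x y ≤ 2 := by
  rcases Nat.eq_zero_or_pos s.ring with h0 | hpos
  · simpa [h0] using s.base.mul_dist_le x hx.1 y hy.1
  have key : ∀ z ∈ s.region σ, ((s.base.level + s.ring : ℕ) : ℝ) * dist z (s.center σ) ≤ 1 := by
    intro z hz
    rcases mem_region_cases hz with rfl | ⟨k, i, hk, hz⟩
    · simp
    · refine le_trans ?_ ((σ s.base).mul_dist_center_le s.idx k i (by omega) z hz)
      unfold center
      gcongr
  have h1 := mul_le_mul_of_nonneg_left (dist_triangle_right x y (s.center σ))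
    (Nat.cast_nonneg (α := ℝ) (s.base.level + s.ring))
  linarith [key x hx, key y hy]

variable (σ)

/-- The state reached from the root set `N` after reading `x 0, …, x n`. -/
def traj (N : ControlledSet X) (x : ℕ → ℕ) : ℕ → SchemeState X
  | 0 => ⟨N, x 0, 0⟩
  | n + 1 => (traj N x n).step σ (x (n + 1))

variable {σ} {N : ControlledSet X}

theorem traj_congr {x y : ℕ → ℕ} {n : ℕ} (h : ∀ i ≤ n, x i = y i) :
    traj σ N x n = traj σ N y n := by
  induction n with
  | zero => simp [traj, h 0 le_rfl]
  | succ n ih => simp only [traj, ih fun i hi => h i (hi.trans n.le_succ), h _ le_rfl]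

theorem antitone_region_traj (x : ℕ → ℕ) : Antitone fun n => (traj σ N x n).region σ :=
  antitone_nat_of_succ_le fun _ => region_step_subset _ _

/-- Each input raises the sum by exactly one: entering a child resets `ring` to 0 but adds `ring +
1` to the level. -/
theorem level_traj (x : ℕ → ℕ) (n : ℕ) :
    (traj σ N x n).base.level + (traj σ N x n).ring = N.level + n := by
  induction n with
  | zero => rfl
  | succ n ih =>
    simp only [traj]
    cases x (n + 1) with
    | zero => simp only [step]; omega
    | succ m => simp only [step, (σ _).level_child]; omega

theorem mul_dist_le_of_mem_traj {x : ℕ → ℕ} {n : ℕ} {u v : X}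
    (hu : u ∈ (traj σ N x n).region σ) (hv : v ∈ (traj σ N x n).region σ) :
    (n : ℝ) * dist u v ≤ 2 := by
  refine le_trans ?_ (mul_dist_le_of_mem_region hu hv)
  rw [level_traj]
  gcongr
  omega

theorem eq_of_mem_traj {x y : ℕ → ℕ} {z : X} (hx : ∀ n, z ∈ (traj σ N x n).region σ)
    (hy : ∀ n, z ∈ (traj σ N y n).region σ) : x = y := by
  suffices h : ∀ n, ∀ i ≤ n, x i = y i from funext fun n => h n n le_rfl
  intro n
  induction n with
  | zero =>
    intro i hi
    obtain rfl := Nat.le_zero.1 hi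
    exact (hx 0).2.1.symm.trans (hy 0).2.1
  | succ n ih =>
    intro i hi
    rcases Nat.le_succ_iff.1 hi with h | rfl
    · exact ih i h
    · have h1 := hx (n + 1)
      have h2 := hy (n + 1)
      simp only [traj] at h1 h2
      rw [traj_congr ih] at h1
      exact step_unique h1 h2

theorem exists_traj_of_mem {z : X} (hz : z ∈ N.carrier) :
    ∃ x : ℕ → ℕ, ∀ n, z ∈ (traj σ N x n).region σ := by
  let s₀ : {s : SchemeState X // z ∈ s.region σ} :=
    ⟨⟨N, ((σ N).label z).1, 0⟩, hz, rfl, fun _ _ => Nat.zero_le _⟩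
  choose a ha using fun s : {s : SchemeState X // z ∈ s.region σ} => exists_mem_region_step s.2
  let s : ℕ → {s : SchemeState X // z ∈ s.region σ} := fun n =>
    Nat.rec s₀ (fun _ s => ⟨s.1.step σ (a s), ha s⟩) n
  let x : ℕ → ℕ := fun n => Nat.casesOn n ((σ N).label z).1 fun n => a (s n)
  have hs : ∀ n, traj σ N x n = (s n).1 := by
    intro n
    induction n with
    | zero => rfl
    | succ n ih => simp only [traj, ih]; rfl
  exact ⟨x, fun n => by rw [hs]; exact (s n).2⟩

theorem base_traj_le {x : ℕ → ℕ} {m n : ℕ} (hmn : m ≤ n) :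
    ∀ a u v, (traj σ N x n).base.ctrl a u = (traj σ N x n).base.ctrl a v →
      (traj σ N x m).base.ctrl a u = (traj σ N x m).base.ctrl a v := by
  induction n, hmn using Nat.le_induction with
  | base => exact fun _ _ _ h => h
  | succ n _ ih =>
    intro a u v h
    refine ih a u v ?_
    simp only [traj] at h
    cases hx : x (n + 1) with
    | zero => simpa only [hx, step] using h
    | succ k =>
      simp only [hx, step] at h
      exact (σ _).ctrl_refines _ _ _ a u v h

theorem monotone_level_traj (x : ℕ → ℕ) : Monotone fun n => (traj σ N x n).base.level := by
  refine monotone_nat_of_le_succ fun n => ?_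
  simp only [traj]
  cases x (n + 1) with
  | zero => exact le_rfl
  | succ m => simp only [step, (σ _).level_child]; omega

/-- Along an input with infinitely many nonzero entries, a limit of points of the regions lies in
every base set that was just entered. -/
theorem mem_base_of_tendsto {x : ℕ → ℕ} (hx : ∃ᶠ n in atTop, x n ≠ 0) {y : ℕ → X} {z : X}
    (hy : ∀ n, y n ∈ (traj σ N x n).region σ) (hz : Tendsto y atTop (𝓝 z)) (n : ℕ) :
    z ∈ (traj σ N x n).base.carrier := by
  have hy' : ∀ m n, m ≤ n → y n ∈ (traj σ N x m).region σ := fun m n h =>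
    antitone_region_traj x h (hy n)
  refine (traj σ N x n).base.controlsLimits y z ?_ hz fun a => ?_
  · filter_upwards [eventually_ge_atTop n] with m hm using (hy' n m hm).1
  -- Two entries are needed: the first resets `ring`, lifting the level to at least `a`; the second
  -- enters a child on which control `a` is therefore constant. `base_traj_le` carries this back to
  -- stage `n`.
  · obtain ⟨p, hp, hxp⟩ := frequently_atTop.1 hx (n + a + 1)
    obtain ⟨q, hq, hxq⟩ := frequently_atTop.1 hx (p + 1)
    obtain ⟨p, rfl⟩ : ∃ p', p = p' + 1 := ⟨p - 1, by omega⟩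
    obtain ⟨q, rfl⟩ : ∃ q', q = q' + 1 := ⟨q - 1, by omega⟩
    have hlevel : a ≤ (traj σ N x q).base.level := by
      have h0 : (traj σ N x (p + 1)).base.level ≤ (traj σ N x q).base.level :=
        monotone_level_traj x (show p + 1 ≤ q by omega)
      have h1 := level_traj (σ := σ) (N := N) x (p + 1)
      obtain ⟨m, hm⟩ := Nat.exists_eq_succ_of_ne_zero hxp
      have h2 : (traj σ N x (p + 1)).ring = 0 := by simp only [traj, hm, step]
      omega
    obtain ⟨m, hm⟩ := Nat.exists_eq_succ_of_ne_zero hxq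
    have hsub : ∀ u ∈ (traj σ N x (q + 1)).region σ, u ∈ ((σ (traj σ N x q).base).child
        (traj σ N x q).idx (traj σ N x q).ring m.unpair.1).carrier := by
      intro u hu
      simp only [traj, hm] at hu
      exact region_step_succ_subset _ _ hu
    refine ⟨(traj σ N x n).base.ctrl a (y (q + 1)), ?_⟩
    filter_upwards [eventually_ge_atTop (q + 1)] with l hl
    exact base_traj_le (by omega) a _ _ ((σ _).ctrl_const _ _ _ a hlevel _
      (hsub _ (hy' _ _ hl)) _ (hsub _ (hy' _ _ le_rfl)))

theorem exists_mem_traj [CompleteSpace X] (x : ℕ → ℕ) :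
    ∃ z, ∀ n, z ∈ (traj σ N x n).region σ := by
  by_cases hx : ∃ᶠ n in atTop, x n ≠ 0
  · let y : ℕ → X := fun n => (traj σ N x n).center σ
    have hy : ∀ n, y n ∈ (traj σ N x n).region σ := fun n => center_mem_region σ _
    have hcauchy : CauchySeq y := by
      refine Metric.cauchySeq_iff'.2 fun ε hε => ?_
      obtain ⟨n, hn⟩ := exists_nat_gt (2 / ε)
      refine ⟨n, fun m hm => ?_⟩
      have h2 := mul_dist_le_of_mem_traj (antitone_region_traj x hm (hy m)) (hy n)
      have h3 : 2 < n * ε := (div_lt_iff₀ hε).1 hn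
      exact lt_of_mul_lt_mul_left (h2.trans_lt h3) (Nat.cast_nonneg n)
    obtain ⟨z, hz⟩ := cauchySeq_tendsto_of_complete hcauchy
    refine ⟨z, fun n => ?_⟩
    -- Lying in the base at stage `n` does not place `z` in the region. The base entered at a later
    -- stage lies inside the preceding region, hence inside region `n`.
    obtain ⟨p, hp, hxp⟩ := frequently_atTop.1 hx (n + 1)
    obtain ⟨p, rfl⟩ : ∃ p', p = p' + 1 := ⟨p - 1, by omega⟩
    obtain ⟨m, hm⟩ := Nat.exists_eq_succ_of_ne_zero hxp
    have hmem := mem_base_of_tendsto hx hy hz (p + 1)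
    simp only [traj, hm, step] at hmem
    refine antitone_region_traj x (show n ≤ p by omega) ?_
    exact child_subset_region _ _ hmem
  · rw [not_frequently, eventually_atTop] at hx
    obtain ⟨n₀, hn₀⟩ := hx
    have hcenter : ∀ n, (traj σ N x (n₀ + n)).center σ = (traj σ N x n₀).center σ := by
      intro n
      induction n with
      | zero => rfl
      | succ n ih =>
        rw [← ih, ← Nat.add_assoc, traj, not_not.1 (hn₀ (n₀ + n + 1) (by omega))]
        rfl
    refine ⟨(traj σ N x n₀).center σ, fun n => ?_⟩
    rw [← hcenter n]
    exact antitone_region_traj x (Nat.le_add_left n n₀) (center_mem_region σ _)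

theorem exists_continuous_bijective [CompleteSpace X] (σ : ∀ N : ControlledSet X, N.Splitting)
    (N : ControlledSet X) :
    ∃ f : (ℕ → ℕ) → N.carrier, Continuous f ∧ Function.Bijective f := by
  choose f hf using fun x => exists_mem_traj (σ := σ) (N := N) x
  refine ⟨fun x => ⟨f x, (antitone_region_traj x (Nat.zero_le 0) (hf x 0)).1⟩,
    Continuous.subtype_mk ?_ _, fun x y hxy => ?_, fun z => ?_⟩
  · rw [continuous_iff_continuousAt]
    intro x
    rw [ContinuousAt, Metric.tendsto_nhds]
    intro ε hε
    obtain ⟨n, hn⟩ := exists_nat_gt (2 / ε)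
    have hev : ∀ᶠ y in 𝓝 x, ∀ i ∈ Finset.range (n + 1), y i = x i :=
      (Finset.eventually_all _).2 fun i _ =>
        (continuous_apply i).continuousAt (isOpen_discrete {x i} |>.mem_nhds rfl)
    filter_upwards [hev] with y hy
    have h1 := hf y n
    rw [traj_congr fun i hi => hy i (Finset.mem_range.2 (Nat.lt_succ_of_le hi))] at h1
    have h2 := mul_dist_le_of_mem_traj h1 (hf x n)
    have h3 : 2 < n * ε := (div_lt_iff₀ hε).1 hn
    have hn0 : (0 : ℝ) < n := (by positivity : 0 < 2 / ε).trans hn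
    exact lt_of_mul_lt_mul_left (h2.trans_lt h3) hn0.le
  · have h : f x = f y := congrArg Subtype.val hxy
    exact eq_of_mem_traj (hf x) (h ▸ hf y)
  · obtain ⟨x, hx⟩ := exists_traj_of_mem (σ := σ) z.2
    refine ⟨x, Subtype.ext ?_⟩
    by_contra hne
    obtain ⟨n, hn⟩ := exists_nat_gt (2 / dist (f x) z)
    have h1 := mul_dist_le_of_mem_traj (hf x n) (hx n)
    have h2 := (div_lt_iff₀ (dist_pos.2 hne)).1 hn
    linarith

end SchemeState

theorem IsSelfCondensed.exists_continuous_bijective [CompleteSpace X] [SecondCountableTopology X]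
    [BorelSpace X] {B : Set X} (hB : IsSelfCondensed B) :
    ∃ f : (ℕ → ℕ) → B, Continuous f ∧ Function.Bijective f := by
  obtain ⟨Φ, hΦ, hc⟩ := hB.measurableSet.exists_controlsLimits
  -- At level 0 the diameter condition is void, so `B` may be unbounded.
  let N : ControlledSet X := ⟨B, Φ, 0, hB, hΦ, hc, by simp⟩
  exact SchemeState.exists_continuous_bijective
    (fun N => N.nonempty_splitting.some) N

end Scheme

theorem mainTheorem4 {X : Type*} [TopologicalSpace X] [PolishSpace X]
    [MeasurableSpace X] [BorelSpace X] (B : Set X) (hB : MeasurableSet B)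
    (hne : B.Nonempty) (hcond : ∀ x ∈ B, IsCondensationPoint x B) :
    ∃ f : (ℕ → ℕ) → B, Continuous f ∧ Function.Bijective f := by
  let := TopologicalSpace.upgradeIsCompletelyMetrizable X
  exact IsSelfCondensed.exists_continuous_bijective ⟨hB, hne, hcond⟩
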